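/- All vector lattices are real and Archimedean. Let $X$ be a vector lattice. A net $(x_\alpha)_{\alpha\in A}$ in $X$ is order convergent to $x$, written $x_\alpha\xrightarrow{o}x$, if there is a net $(y_\beta)_{\beta\in B}$ in $X$, possibly over a different index set, such that $y_\beta\downarrow 0$ and for every $\beta\in B$ there is $\alpha_0\in A$ with $|x_\alpha-x|\le y_\beta$ for all $\alpha\ge\alpha_0$. It is $uo$-convergent to $x$ if $|x_\alpha-x|\wedge u\xrightarrow{o}0$ for every $u\in X_+$. An atom is an element $x>0$ such that the ideal generated by $x$ equals the linear span of $x$; $X$ is atomic if there is a set $D$ of pairwise disjoint atoms such that $x\in X$ and $x\wedge d=0$ for all $d\in D$ imply $x=0$ (in particular the zero space is atomic). A locally convex-solid topology on $X$ is a (not necessarily Hausdorff) linear topology that is locally convex and has a base at zero consisting of solid sets. **Theorem.** Let $X$ be an Archimedean vector lattice. Then the following are equivalent: (i) there is a locally convex-solid topology $\tau$ on $X$ such that a net in $X$ is $uo$-convergent to $x\in X$ if and only if it converges to $x$ with respect to $\tau$; (ii) $X$ is atomic. Moreover, if $X$ is atomic, then there are a set $S$ and a lattice isomorphism $T$ (linear,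 injective, preserving $\vee$ and $\wedge$) from $X$ onto an order dense sublattice of $\mathbb{R}^S$ (that is, for every $0<f\in\mathbb{R}^S$ there is $x\in X$ with $0<Tx\le f$); and for every such $S$ and $T$, a net $(x_\alpha)$ in $X$ is $uo$-convergent to $x\in X$ if and only if $(Tx_\alpha)(s)\to (Tx)(s)$ for every $s\in S$. -/

import Mathlib

open Filter Topology

universe u v w

section VectorLattice

variable {X : Type u} [Lattice X] [AddCommGroup X]

/-- The vector lattice `X` is Archimedean: if `n x ≤ y` for all natural numbers `n`,
then `x ≤ 0`. -/
def IsArchimedeanVL (X : Type u) [Lattice X] [AddCommGroup X] : Prop :=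
  ∀ x y : X, (∀ n : ℕ, n • x ≤ y) → x ≤ 0

/-- `y_β ↓ 0`: the net `y` is decreasing with infimum `0`. -/
def DecreasesToZero {B : Type v} [Preorder B] (y : B → X) : Prop :=
  Antitone y ∧ IsGLB (Set.range y) 0

/-- Order convergence of the net `x` to `a`. The dominating net `y` may have a different index set.
An index set in the universe of `X` is no restriction: a decreasing net may be replaced by its
range with the reversed order. -/
def OrderConverges {A : Type v} [Preorder A] (x : A → X) (a : X) : Prop :=
  ∃ (B : Type u) (_ : Preorder B) (_ : IsDirectedOrder B) (_ : Nonempty B) (y : B → X),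
    DecreasesToZero y ∧ ∀ β : B, ∃ α₀ : A, ∀ α : A, α₀ ≤ α → |x α - a| ≤ y β

/-- Unbounded order convergence (uo-convergence) of the net `x` to `a`. -/
def UOConverges {A : Type v} [Preorder A] (x : A → X) (a : X) : Prop :=
  ∀ u : X, 0 ≤ u → OrderConverges (fun α => |x α - a| ⊓ u) 0

/-- `Y` is order dense in `X`: below each `x > 0` in `X` there is some `y > 0` in `Y`. -/
def IsOrderDense (Y : Set X) : Prop :=
  ∀ x : X, 0 < x → ∃ y ∈ Y, 0 < y ∧ y ≤ x

variable [Module ℝ X]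

/-- The (order) ideal generated by `S`: the least solid linear subspace containing `S`. -/
def idealGenerated (S : Set X) : Submodule ℝ X :=
  sInf {I : Submodule ℝ X | S ⊆ I ∧ LatticeOrderedAddCommGroup.IsSolid (I : Set X)}

/-- A discrete element (atom): `x > 0` and the ideal generated by `x` is the linear span of `x`. -/
def IsDiscreteElement (x : X) : Prop :=
  0 < x ∧ idealGenerated {x} = Submodule.span ℝ {x}

/-- `X` is atomic: it has a complete disjoint system consisting of discrete elements.
The zero space is atomic, through the empty system. -/
def IsAtomicVL (X : Type u) [Lattice X] [AddCommGroup X] [Module ℝ X] : Prop :=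
  ∃ D : Set X, (∀ d ∈ D, IsDiscreteElement d) ∧
    (∀ d ∈ D, ∀ e ∈ D, d ≠ e → d ⊓ e = 0) ∧
    ∀ x : X, (∀ d ∈ D, x ⊓ d = 0) → x = 0

/-- `t` is a locally solid topology on `X` (not necessarily Hausdorff): a linear topology with a
base at zero consisting of solid sets. -/
structure IsLocallySolid (t : TopologicalSpace X) : Prop where
  isTopologicalAddGroup : IsTopologicalAddGroup X
  continuousSMul : ContinuousSMul ℝ X
  solid_basis : (𝓝 (0 : X)).HasBasis
    (fun U : Set X => U ∈ 𝓝 (0 : X) ∧ LatticeOrderedAddCommGroup.IsSolid U) id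

/-- `t` is a locally convex-solid topology on `X`: locally solid and locally convex. -/
structure IsLocallyConvexSolid (t : TopologicalSpace X) : Prop extends IsLocallySolid t where
  locallyConvex : LocallyConvexSpace ℝ X

/-- `T` is a lattice isomorphism of `X` onto an order dense sublattice of `ℝ^S`. -/
structure IsOrderDenseEmbedding {S : Type w} (T : X →ₗ[ℝ] (S → ℝ)) : Prop where
  injective : Function.Injective T
  map_sup : ∀ x y : X, T (x ⊔ y) = T x ⊔ T y
  map_inf : ∀ x y : X, T (x ⊓ y) = T x ⊓ T y
  orderDense : IsOrderDense (Set.range T)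

end VectorLattice

set_option linter.unusedSectionVars false

/-! ### Disjoint positive elements -/

section DisjointElements

variable {X : Type u} [Lattice X] [AddCommGroup X] [IsOrderedAddMonoid X]

/-! Atomic implies topological. For an atom `d`, the Archimedean property splits `X` into the line
through `d` and the elements disjoint from `d`. The coefficients along `d` form a lattice
homomorphism to `ℝ`, and over a complete disjoint system of atoms they give an order dense embedding
`T` (`IsAtomicVL.exists_embedding`). For any such `T` the unit vectors lie in its range. Testing
uo-convergence against them gives pointwise convergence; conversely, cutting `u` down at finitely
many coordinates stays in `X` and produces a dominating family with infimum `0` (`uoConverges_iff`).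

Topological implies atomic. Given `x > 0`, choose a convex neighbourhood `C` of `0` missing `x`, and
consider the positive elements whose multiples have their order intervals in `C` (`nullCone`). If
they were order dense below `x`, the net `x - z` over such `z ≤ x` would decrease to `0`, and `x`,
the midpoint of `2(x - z)` and `2z`, would lie in `C`. So some `0 < y ≤ x` dominates no nonzero such
`z`. If no atom lay below `x`, there would be an infinite disjoint sequence below `y`; suitable
elements below multiples of its terms avoid `C`, yet are disjoint and hence uo-null
(`uoConverges_zero_of_disjoint`). -/

theorem add_inf_le_inf_add_inf {a b c : X} (ha : 0 ≤ a) (hb : 0 ≤ b) (hc : 0 ≤ c) :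
    (a + b) ⊓ c ≤ a ⊓ c + b ⊓ c := by
  rw [inf_add, add_inf, add_inf]
  refine le_inf (le_inf inf_le_left ?_) (le_inf ?_ ?_)
  · exact inf_le_right.trans (le_add_of_nonneg_left ha)
  · exact inf_le_right.trans (le_add_of_nonneg_right hb)
  · exact inf_le_right.trans (le_add_of_nonneg_right hc)

theorem add_le_of_inf_eq_zero {a b c : X} (h : a ⊓ b = 0) (ha : a ≤ c) (hb : b ≤ c) :
    a + b ≤ c := by
  rw [← inf_add_sup a b, h, zero_add]
  exact sup_le ha hb

theorem inf_eq_zero_mono {a b a' b' : X} (h : a ⊓ b = 0) (ha' : 0 ≤ a') (hb' : 0 ≤ b')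
    (ha : a' ≤ a) (hb : b' ≤ b) : a' ⊓ b' = 0 :=
  le_antisymm ((inf_le_inf ha hb).trans h.le) (le_inf ha' hb')

theorem add_inf_eq_zero {a b c : X} (ha : a ⊓ c = 0) (hb : b ⊓ c = 0) : (a + b) ⊓ c = 0 := by
  have ha0 : 0 ≤ a := ha.ge.trans inf_le_left
  have hb0 : 0 ≤ b := hb.ge.trans inf_le_left
  have hc0 : 0 ≤ c := ha.ge.trans inf_le_right
  refine le_antisymm ?_ (le_inf (add_nonneg ha0 hb0) hc0)
  simpa [ha, hb] using add_inf_le_inf_add_inf ha0 hb0 hc0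

theorem nsmul_inf_eq_zero {a b : X} (h : a ⊓ b = 0) (n : ℕ) : (n • a) ⊓ b = 0 := by
  induction n with
  | zero => simpa using h.ge.trans inf_le_right
  | succ n ih => rw [succ_nsmul]; exact add_inf_eq_zero ih h

/-- In an Archimedean vector lattice, if `n v ≤ u` always implies `(n + 1) v ≤ u`, where `0 ≤ u`,
then `v ≤ 0`. -/
theorem IsArchimedeanVL.le_zero_of_step (hX : IsArchimedeanVL X) {u v : X} (hu : 0 ≤ u)
    (h : ∀ n : ℕ, n • v ≤ u → (n + 1) • v ≤ u) : v ≤ 0 :=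
  hX v u fun n => by
    induction n with
    | zero => simpa using hu
    | succ n ih => exact h n ih

end DisjointElements

/-! ### Real multiples, disjoint complements and a criterion for atoms -/

section Scalars

variable {X : Type u} [Lattice X] [AddCommGroup X] [IsOrderedAddMonoid X]
  [Module ℝ X] [IsOrderedModule ℝ X]

theorem abs_smul_eq (c : ℝ) (x : X) : |c • x| = |c| • |x| := by
  have key : ∀ c : ℝ, 0 < c → |c • x| = c • |x| := fun c hc => by
    rw [abs, abs, ← smul_neg]
    exact ((OrderIso.smulRight hc).map_sup x (-x)).symm
  rcases lt_trichotomy c 0 with hc | rfl | hc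
  · rw [← abs_neg, ← neg_smul, key _ (neg_pos.2 hc), abs_of_neg hc]
  · simp
  · rw [key c hc, abs_of_pos hc]

theorem smul_inf_eq_zero {a b : X} (h : a ⊓ b = 0) {c : ℝ} (hc : 0 ≤ c) : (c • a) ⊓ b = 0 := by
  have ha : 0 ≤ a := h.ge.trans inf_le_left
  obtain ⟨n, hn⟩ := exists_nat_ge c
  refine inf_eq_zero_mono (nsmul_inf_eq_zero h n) (smul_nonneg hc ha) (h.ge.trans inf_le_right)
    ?_ le_rfl
  rw [← Nat.cast_smul_eq_nsmul ℝ]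
  exact smul_le_smul_of_nonneg_right hn ha

theorem smul_inf_smul_eq_zero {a b : X} (h : a ⊓ b = 0) {c c' : ℝ} (hc : 0 ≤ c) (hc' : 0 ≤ c') :
    (c • a) ⊓ (c' • b) = 0 := by
  rw [inf_comm]
  refine smul_inf_eq_zero ?_ hc'
  rw [inf_comm]
  exact smul_inf_eq_zero h hc

/-- Taking `μ = c - 1/n` bounds `n (c d - x)` by `d`. This lets suprema of admissible coefficients
be attained. -/
theorem IsArchimedeanVL.smul_le_of_forall_lt (hX : IsArchimedeanVL X) {d x : X} (hd : 0 ≤ d)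
    {c : ℝ} (h : ∀ μ < c, μ • d ≤ x) : c • d ≤ x := by
  rw [← sub_nonpos]
  refine hX _ d fun n => ?_
  rcases n.eq_zero_or_pos with rfl | hn
  · simpa using hd
  have hn' : (0 : ℝ) < n := by exact_mod_cast hn
  have h1 := smul_le_smul_of_nonneg_left (h (c - (n : ℝ)⁻¹) (by simpa using hn)) hn'.le
  rw [smul_smul, mul_sub, mul_inv_cancel₀ hn'.ne', sub_smul, one_smul, ← smul_smul] at h1
  rw [← Nat.cast_smul_eq_nsmul ℝ, smul_sub, sub_le_comm]
  exact h1

theorem IsArchimedeanVL.le_smul_of_forall_gt (hX : IsArchimedeanVL X) {d x : X} (hd : 0 ≤ d)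
    {c : ℝ} (h : ∀ μ > c, x ≤ μ • d) : x ≤ c • d := by
  have := hX.smul_le_of_forall_lt (x := -x) (c := -c) hd fun μ hμ => by
    have := h (-μ) (lt_neg_of_lt_neg hμ)
    rw [neg_smul] at this
    exact le_neg_of_le_neg this
  rw [neg_smul] at this
  exact neg_le_neg_iff.1 this

theorem nonneg_of_smul_nonneg {d : X} (hd : 0 < d) {c : ℝ} (h : 0 ≤ c • d) : 0 ≤ c := by
  by_contra! hc
  have h1 : 0 ≤ (-c)⁻¹ • (c • d) := smul_nonneg (by simpa using hc.le) h
  rw [smul_smul, inv_neg, neg_mul, inv_mul_cancel₀ hc.ne, neg_one_smul] at h1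
  exact hd.not_ge (neg_nonneg.1 h1)

/-- The elements disjoint from `d`. -/
def disjointComplement (d : X) (hd : 0 ≤ d) : Submodule ℝ X where
  carrier := {x | |x| ⊓ d = 0}
  zero_mem' := by simpa using hd
  add_mem' {a b} ha hb :=
    inf_eq_zero_mono (add_inf_eq_zero ha hb) (abs_nonneg _) hd (abs_add_le a b) le_rfl
  smul_mem' c a ha := by
    rw [Set.mem_ofPred_eq, abs_smul_eq]
    exact smul_inf_eq_zero ha (abs_nonneg c)

theorem mem_disjointComplement {d : X} (hd : 0 ≤ d) {x : X} :
    x ∈ disjointComplement d hd ↔ |x| ⊓ d = 0 := Iff.rfl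

theorem mem_disjointComplement_of_abs_le {d : X} (hd : 0 ≤ d) {x y : X}
    (hx : x ∈ disjointComplement d hd) (h : |y| ≤ |x|) : y ∈ disjointComplement d hd :=
  inf_eq_zero_mono hx (abs_nonneg _) hd h le_rfl

theorem IsDiscreteElement.exists_smul {d y : X} (hd : IsDiscreteElement d) (hy : 0 ≤ y)
    (hyd : y ≤ d) : ∃ c : ℝ, c • d = y := by
  rw [← Submodule.mem_span_singleton, ← hd.2, idealGenerated, Submodule.mem_sInf]
  rintro I ⟨h1, h2⟩
  refine h2 (h1 rfl) ?_
  rwa [abs_of_nonneg hy, abs_of_nonneg hd.1.le]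

/-- The condition rescales from `[0, d]` to `[0, c d]`, so the span of `d` is solid and is itself
the ideal generated by `d`. -/
theorem isDiscreteElement_of_forall {d : X} (hd : 0 < d)
    (h : ∀ y, 0 ≤ y → y ≤ d → ∃ c : ℝ, c • d = y) : IsDiscreteElement d := by
  have hpos : ∀ (c : ℝ) (y : X), 0 ≤ y → y ≤ c • d → y ∈ Submodule.span ℝ {d} := by
    intro c y hy hyc
    have hc : 0 ≤ c := nonneg_of_smul_nonneg hd (hy.trans hyc)
    rcases hc.eq_or_lt with rfl | hc
    · rw [zero_smul] at hyc
      rw [le_antisymm hyc hy]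
      exact zero_mem _
    obtain ⟨b, hb⟩ := h (c⁻¹ • y) (smul_nonneg (inv_nonneg.2 hc.le) hy) (by
      have := smul_le_smul_of_nonneg_left hyc (inv_nonneg.2 hc.le)
      rwa [smul_smul, inv_mul_cancel₀ hc.ne', one_smul] at this)
    rw [Submodule.mem_span_singleton]
    refine ⟨c * b, ?_⟩
    rw [mul_smul, hb, smul_smul, mul_inv_cancel₀ hc.ne', one_smul]
  refine ⟨hd, le_antisymm (sInf_le ⟨Submodule.subset_span, ?_⟩) ?_⟩
  · intro x hx y hyx
    obtain ⟨c, rfl⟩ := Submodule.mem_span_singleton.1 hx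
    rw [abs_smul_eq, abs_of_nonneg hd.le] at hyx
    rw [← posPart_sub_negPart y]
    refine sub_mem (hpos |c| _ (posPart_nonneg y) ?_) (hpos |c| _ (negPart_nonneg y) ?_)
    · exact (sup_le (le_abs_self y) (abs_nonneg y)).trans hyx
    · exact (sup_le (neg_le_abs y) (abs_nonneg y)).trans hyx
  · rw [Submodule.span_singleton_le_iff_mem, idealGenerated, Submodule.mem_sInf]
    exact fun I hI => hI.1 rfl

/-- A positive element below which any two disjoint positive elements contain `0` is an atom. -/
theorem IsArchimedeanVL.isDiscreteElement_of_disjoint (hX : IsArchimedeanVL X) {d : X} (hd : 0 < d)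
    (h : ∀ a b : X, 0 < a → 0 < b → a ≤ d → b ≤ d → a ⊓ b ≠ 0) : IsDiscreteElement d := by
  refine isDiscreteElement_of_forall hd fun z hz hzd => ?_
  -- The coefficient is `sInf A`. For `0 ≤ μ < sInf A` the positive part of `z - μ d` is nonzero;
  -- both parts lie below `d` and are disjoint, so the negative part vanishes and `μ d ≤ z`.
  set A : Set ℝ := {μ | 0 ≤ μ ∧ z ≤ μ • d} with hA
  have hA1 : (1 : ℝ) ∈ A := ⟨zero_le_one, by rwa [one_smul]⟩
  have hbdd : BddBelow A := ⟨0, fun μ hμ => hμ.1⟩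
  refine ⟨sInf A, le_antisymm (hX.smul_le_of_forall_lt hd.le fun μ hμ => ?_)
    (hX.le_smul_of_forall_gt hd.le fun μ hμ => ?_)⟩
  · rcases lt_or_ge μ 0 with hμ0 | hμ0
    · exact (smul_nonpos_of_nonpos_of_nonneg hμ0.le hd.le).trans hz
    have hμA : μ ∉ A := notMem_of_lt_csInf hμ hbdd
    have hμ1 : μ ≤ 1 := hμ.le.trans (csInf_le hbdd hA1)
    have hp : (z - μ • d)⁺ ≠ 0 := fun h0 => hμA ⟨hμ0, sub_nonpos.1 (posPart_eq_zero.1 h0)⟩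
    by_contra hn
    have hq : (z - μ • d)⁻ ≠ 0 := fun h0 => hn (sub_nonneg.1 (negPart_eq_zero.1 h0))
    refine h _ _ ((posPart_nonneg _).lt_of_ne' hp) ((negPart_nonneg _).lt_of_ne' hq) ?_ ?_
      (posPart_inf_negPart_eq_zero _)
    · exact sup_le ((sub_le_self _ (smul_nonneg hμ0 hd.le)).trans hzd) hd.le
    · refine sup_le ?_ hd.le
      rw [neg_sub]
      refine (sub_le_self _ hz).trans ?_
      simpa using smul_le_smul_of_nonneg_right hμ1 hd.le
  · obtain ⟨ν, hν, hνμ⟩ := exists_lt_of_csInf_lt ⟨1, hA1⟩ hμ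
    exact hν.2.trans (smul_le_smul_of_nonneg_right hνμ.le hd.le)

end Scalars

/-! ### Coordinates along atoms -/

section Coordinates

variable {X : Type u} [Lattice X] [AddCommGroup X] [IsOrderedAddMonoid X]
  [Module ℝ X] [IsOrderedModule ℝ X]

theorem eq_zero_of_smul_mem_disjointComplement {d : X} (hd : 0 < d) {c : ℝ}
    (h : c • d ∈ disjointComplement d hd.le) : c = 0 := by
  by_contra hc
  have hc' : |c|⁻¹ • (c • d) ∈ disjointComplement d hd.le := Submodule.smul_mem _ _ h
  rw [mem_disjointComplement, abs_smul_eq, abs_smul_eq, abs_inv, abs_abs, smul_smul,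
    inv_mul_cancel₀ (abs_ne_zero.2 hc), one_smul, abs_of_nonneg hd.le, inf_idem] at hc'
  exact hd.ne' hc'

/-- Take the largest `c` with `c d ≤ x`. The remainder meets `d` in a multiple of `d`, which
maximality forces to be `0`. -/
theorem IsDiscreteElement.exists_sub_smul_mem_of_nonneg (hX : IsArchimedeanVL X) {d : X}
    (hd : IsDiscreteElement d) {x : X} (hx : 0 ≤ x) :
    ∃ c : ℝ, x - c • d ∈ disjointComplement d hd.1.le := by
  set A : Set ℝ := {c | c • d ≤ x} with hA
  have h0 : (0 : ℝ) ∈ A := by rwa [hA, Set.mem_ofPred_eq, zero_smul]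
  have hbdd : BddAbove A := by
    by_contra hb
    refine hd.1.not_ge (hX d x fun n => ?_)
    obtain ⟨c, hc, hnc⟩ := not_bddAbove_iff.1 hb n
    rw [← Nat.cast_smul_eq_nsmul ℝ]
    exact (smul_le_smul_of_nonneg_right hnc.le hd.1.le).trans hc
  have hle : sSup A • d ≤ x := hX.smul_le_of_forall_lt hd.1.le fun μ hμ => by
    obtain ⟨c, hc, hμc⟩ := exists_lt_of_lt_csSup ⟨0, h0⟩ hμ
    exact (smul_le_smul_of_nonneg_right hμc.le hd.1.le).trans hc
  refine ⟨sSup A, ?_⟩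
  rw [mem_disjointComplement, abs_of_nonneg (sub_nonneg.2 hle)]
  have hinf : 0 ≤ (x - sSup A • d) ⊓ d := le_inf (sub_nonneg.2 hle) hd.1.le
  obtain ⟨c, hc⟩ := hd.exists_smul hinf inf_le_right
  have hc0 : 0 ≤ c := nonneg_of_smul_nonneg hd.1 (hc ▸ hinf)
  have hmem : sSup A + c ∈ A := by
    rw [hA, Set.mem_ofPred_eq, add_smul, ← le_sub_iff_add_le', hc]
    exact inf_le_left
  have : c = 0 := le_antisymm (by linarith [le_csSup hbdd hmem]) hc0
  rw [← hc, this, zero_smul]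

theorem IsDiscreteElement.exists_sub_smul_mem (hX : IsArchimedeanVL X) {d : X}
    (hd : IsDiscreteElement d) (x : X) :
    ∃ c : ℝ, x - c • d ∈ disjointComplement d hd.1.le := by
  obtain ⟨a, ha⟩ := hd.exists_sub_smul_mem_of_nonneg hX (posPart_nonneg x)
  obtain ⟨b, hb⟩ := hd.exists_sub_smul_mem_of_nonneg hX (negPart_nonneg x)
  refine ⟨a - b, ?_⟩
  convert sub_mem ha hb using 1
  nth_rewrite 1 [← posPart_sub_negPart x]
  rw [sub_smul]
  abel

/-- The coordinate of `x` along the atom `d`. -/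
noncomputable def IsDiscreteElement.coord (hX : IsArchimedeanVL X) {d : X}
    (hd : IsDiscreteElement d) (x : X) : ℝ :=
  (hd.exists_sub_smul_mem hX x).choose

theorem IsDiscreteElement.sub_coord_smul_mem (hX : IsArchimedeanVL X) {d : X}
    (hd : IsDiscreteElement d) (x : X) :
    x - hd.coord hX x • d ∈ disjointComplement d hd.1.le :=
  (hd.exists_sub_smul_mem hX x).choose_spec

theorem IsDiscreteElement.coord_eq (hX : IsArchimedeanVL X) {d : X}
    (hd : IsDiscreteElement d) {x : X} {c : ℝ} (h : x - c • d ∈ disjointComplement d hd.1.le) :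
    hd.coord hX x = c := by
  have := sub_mem h (hd.sub_coord_smul_mem hX x)
  rw [sub_sub_sub_cancel_left, ← sub_smul] at this
  exact sub_eq_zero.1 (eq_zero_of_smul_mem_disjointComplement hd.1 this)

/-- The coordinate along an atom as a linear functional. -/
noncomputable def IsDiscreteElement.coordLinear (hX : IsArchimedeanVL X) {d : X}
    (hd : IsDiscreteElement d) : X →ₗ[ℝ] ℝ where
  toFun := hd.coord hX
  map_add' x y := hd.coord_eq hX <| by
    convert add_mem (hd.sub_coord_smul_mem hX x) (hd.sub_coord_smul_mem hX y) using 1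
    rw [add_smul]
    abel
  map_smul' c x := hd.coord_eq hX <| by
    convert Submodule.smul_mem _ c (hd.sub_coord_smul_mem hX x) using 1
    rw [smul_sub, smul_smul, RingHom.id_apply, smul_eq_mul]

/-- Since `||x| - |c d|| ≤ |x - c d|`, solidity of the disjoint complement passes the decomposition
from `x` to `|x|`. As `⊔` and `⊓` are expressible through absolute values, the coordinate is a
lattice homomorphism. -/
theorem IsDiscreteElement.coordLinear_abs (hX : IsArchimedeanVL X) {d : X}
    (hd : IsDiscreteElement d) (x : X) : hd.coordLinear hX |x| = |hd.coordLinear hX x| := by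
  refine hd.coord_eq hX (mem_disjointComplement_of_abs_le hd.1.le (hd.sub_coord_smul_mem hX x) ?_)
  have := abs_abs_sub_abs_le x (hd.coord hX x • d)
  rwa [abs_smul_eq, abs_of_nonneg hd.1.le] at this

theorem IsDiscreteElement.coordLinear_self (hX : IsArchimedeanVL X) {d : X}
    (hd : IsDiscreteElement d) : hd.coordLinear hX d = 1 :=
  hd.coord_eq hX (by rw [one_smul, sub_self]; exact zero_mem _)

theorem IsDiscreteElement.coordLinear_of_disjoint (hX : IsArchimedeanVL X) {d e : X}
    (hd : IsDiscreteElement d) (he : 0 ≤ e) (h : e ⊓ d = 0) : hd.coordLinear hX e = 0 :=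
  hd.coord_eq hX (by rwa [zero_smul, sub_zero, mem_disjointComplement, abs_of_nonneg he])

theorem IsDiscreteElement.inf_eq_zero_of_coordLinear (hX : IsArchimedeanVL X) {d x : X}
    (hd : IsDiscreteElement d) (h : hd.coordLinear hX x = 0) : |x| ⊓ d = 0 := by
  have := hd.sub_coord_smul_mem hX x
  rwa [show hd.coord hX x = 0 from h, zero_smul, sub_zero] at this

/-- An atomic Archimedean vector lattice embeds as an order dense sublattice of a power of `ℝ`. -/
theorem IsAtomicVL.exists_embedding (hX : IsArchimedeanVL X) (h : IsAtomicVL X) :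
    ∃ (S : Type u) (T : X →ₗ[ℝ] (S → ℝ)), IsOrderDenseEmbedding T := by
  obtain ⟨D, hD, hdisj, hcomp⟩ := h
  set T : X →ₗ[ℝ] (D → ℝ) := LinearMap.pi fun d : D => (hD d d.2).coordLinear hX with hT
  have habs : ∀ x, T |x| = |T x| := fun x => funext fun d => (hD d d.2).coordLinear_abs hX x
  refine ⟨D, T, (injective_iff_map_eq_zero T).2 fun x hx => ?_, fun x y => ?_, fun x y => ?_, ?_⟩
  · have := hcomp |x| fun d hd => (hD d hd).inf_eq_zero_of_coordLinear hX (congr_fun hx ⟨d, hd⟩)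
    exact le_antisymm ((le_abs_self x).trans this.le)
      (neg_nonpos.1 ((neg_le_abs x).trans this.le))
  · rw [sup_eq_half_smul_add_add_abs_sub' ℝ, sup_eq_half_smul_add_add_abs_sub' ℝ, map_smul,
      map_add, map_add, habs, map_sub]
  · rw [inf_eq_half_smul_add_sub_abs_sub' ℝ, inf_eq_half_smul_add_sub_abs_sub' ℝ, map_smul,
      map_sub, map_add, habs, map_sub]
  -- If `f d > 0`, the multiple `f d • d` of that single atom is mapped below `f`.
  · intro f hf
    obtain ⟨hf0, d, hd⟩ := Pi.lt_def.1 hf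
    have hself : T (f d • (d : X)) d = f d := by
      rw [map_smul, Pi.smul_apply, smul_eq_mul]
      exact (congrArg (f d * ·) ((hD d d.2).coordLinear_self hX)).trans (mul_one _)
    have hother : ∀ e : D, e ≠ d → T (f d • (d : X)) e = 0 := fun e he => by
      rw [map_smul, Pi.smul_apply, smul_eq_mul]
      refine (congrArg (f d * ·) ((hD e e.2).coordLinear_of_disjoint hX (hD d d.2).1.le
        (hdisj d d.2 e e.2 fun h => he (Subtype.ext h.symm)))).trans (mul_zero _)
    refine ⟨_, ⟨f d • (d : X), rfl⟩, Pi.lt_def.2 ⟨fun e => ?_, d, ?_⟩, fun e => ?_⟩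
    · rcases eq_or_ne e d with rfl | he
      · rw [hself]; exact hd.le
      · rw [hother e he]; exact le_rfl
    · rw [hself]; exact hd
    · rcases eq_or_ne e d with rfl | he
      · rw [hself]
      · rw [hother e he]; exact hf0 e

end Coordinates

/-! ### Order and uo-convergence -/

section OrderConvergence

variable {X : Type u} [Lattice X] [AddCommGroup X] [IsOrderedAddMonoid X]

/-- Order convergence can be tested with a downward directed set of eventual bounds. -/
theorem orderConverges_of_set {A : Type v} [Preorder A] {x : A → X} {a : X} (Y : Set X)
    (hne : Y.Nonempty) (hdir : ∀ y ∈ Y, ∀ z ∈ Y, ∃ t ∈ Y, t ≤ y ∧ t ≤ z)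
    (hglb : ∀ w, 0 ≤ w → (∀ y ∈ Y, w ≤ y) → w = 0) (hnonneg : ∀ y ∈ Y, 0 ≤ y)
    (h : ∀ y ∈ Y, ∃ α₀ : A, ∀ α : A, α₀ ≤ α → |x α - a| ≤ y) : OrderConverges x a := by
  refine ⟨(Y : Type u)ᵒᵈ, inferInstance, ⟨fun y z => ?_⟩, ?_, fun y => ((OrderDual.ofDual y : Y) : X),
    ⟨fun y z hyz => hyz, ?_, ?_⟩, fun y => h _ (OrderDual.ofDual y).2⟩
  · obtain ⟨t, ht, hty, htz⟩ := hdir _ (OrderDual.ofDual y).2 _ (OrderDual.ofDual z).2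
    exact ⟨OrderDual.toDual ⟨t, ht⟩, hty, htz⟩
  · obtain ⟨y, hy⟩ := hne
    exact ⟨OrderDual.toDual ⟨y, hy⟩⟩
  · rintro _ ⟨y, rfl⟩
    exact hnonneg _ (OrderDual.ofDual y).2
  · intro w hw
    have : w ⊔ 0 = 0 := hglb _ le_sup_right fun y hy =>
      sup_le (hw ⟨OrderDual.toDual ⟨y, hy⟩, rfl⟩) (hnonneg y hy)
    exact le_sup_left.trans this.le

theorem OrderConverges.mono {A : Type v} [Preorder A] {x y : A → X} {a b : X}
    (hx : OrderConverges x a) (h : ∀ α, |y α - b| ≤ |x α - a|) : OrderConverges y b := by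
  obtain ⟨B, i₁, i₂, i₃, z, hz, hzx⟩ := hx
  exact ⟨B, i₁, i₂, i₃, z, hz, fun β => (hzx β).imp fun α₀ hα α hαα => (h α).trans (hα α hαα)⟩

theorem OrderConverges.uoConverges {A : Type v} [Preorder A] {x : A → X} {a : X}
    (hx : OrderConverges x a) : UOConverges x a := fun u hu => hx.mono fun α => by
  rw [sub_zero, abs_of_nonneg (le_inf (abs_nonneg _) hu)]
  exact inf_le_left

/-- This later separates `x` from `0` in a topology that is not assumed Hausdorff. -/
theorem not_uoConverges_const {A : Type v} [Preorder A] {x : X} (hx : 0 < x) :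
    ¬ UOConverges (fun _ : A => x) 0 := fun h => by
  obtain ⟨B, _, _, _, y, hy, hyx⟩ := h x hx.le
  refine hx.not_ge (hy.2.2 ?_)
  rintro _ ⟨β, rfl⟩
  obtain ⟨α₀, hα⟩ := hyx β
  simpa [abs_of_pos hx] using hα α₀ le_rfl

end OrderConvergence

/-! ### uo-convergence as pointwise convergence -/

section Pointwise

variable {X : Type u} [Lattice X] [AddCommGroup X] [IsOrderedAddMonoid X]
  [Module ℝ X] [IsOrderedModule ℝ X] {S : Type w} {T : X →ₗ[ℝ] (S → ℝ)}

namespace IsOrderDenseEmbedding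

theorem le_iff (hT : IsOrderDenseEmbedding T) {x y : X} : T x ≤ T y ↔ x ≤ y := by
  rw [← sup_eq_right, ← hT.map_sup, hT.injective.eq_iff, sup_eq_right]

theorem map_abs (hT : IsOrderDenseEmbedding T) (x : X) : T |x| = |T x| := by
  rw [abs, hT.map_sup, map_neg, abs]

-- A nonzero positive element of the range below the unit vector at `s` is supported at `s`; rescale
-- it.
open Classical in
theorem exists_single (hT : IsOrderDenseEmbedding T) (s : S) :
    ∃ e : X, T e = Pi.single s 1 := by
  obtain ⟨_, ⟨e, rfl⟩, he0, he1⟩ := hT.orderDense (Pi.single s (1 : ℝ)) (by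
    refine Pi.lt_def.2 ⟨Pi.single_nonneg.2 zero_le_one, s, by simp⟩)
  obtain ⟨hnn, t, ht⟩ := Pi.lt_def.1 he0
  have hzero : ∀ t ≠ s, T e t = 0 := fun t hts =>
    le_antisymm ((he1 t).trans (by simp [hts])) (hnn t)
  have hts : t = s := by
    by_contra hts
    exact ht.ne' (hzero t hts)
  subst hts
  refine ⟨(T e t)⁻¹ • e, funext fun r => ?_⟩
  rw [map_smul, Pi.smul_apply, smul_eq_mul]
  rcases eq_or_ne r t with rfl | hr
  · rw [Pi.single_eq_same, inv_mul_cancel₀ ht.ne']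
  · rw [hzero r hr, mul_zero, Pi.single_eq_of_ne hr]

theorem tendsto_of_uoConverges (hT : IsOrderDenseEmbedding T) {A : Type v} [Preorder A]
    [IsDirectedOrder A] [Nonempty A] {x : A → X} {a : X} (h : UOConverges x a) (s : S) :
    Tendsto (fun α => T (x α) s) atTop (𝓝 (T a s)) := by
  classical
  obtain ⟨e, he⟩ := hT.exists_single s
  have he0 : 0 ≤ e := by
    rw [← hT.le_iff, map_zero, he]
    exact Pi.single_nonneg.2 zero_le_one
  obtain ⟨B, _, _, _, y, ⟨-, hy⟩, hyx⟩ := h e he0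
  have hy0 : ∀ β t, 0 ≤ T (y β) t := fun β => by
    have := hT.le_iff.2 (hy.1 ⟨β, rfl⟩)
    rwa [map_zero] at this
  refine Metric.tendsto_nhds.2 fun ε hε => ?_
  -- Otherwise `min ε 1 • e` would be a positive lower bound of `y`. The cap at `1` matters because
  -- truncation by `e` only bounds `min |T (x α) s - T a s| 1`.
  obtain ⟨β, hβ⟩ : ∃ β, T (y β) s < min ε 1 := by
    by_contra! hcon
    have hε' : (0 : ℝ) < min ε 1 := lt_min hε one_pos
    have hle : min ε 1 • e ≤ 0 := hy.2 <| by
      rintro _ ⟨β, rfl⟩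
      rw [← hT.le_iff, map_smul, he]
      intro t
      rcases eq_or_ne t s with rfl | ht
      · simpa using hcon β
      · simpa [ht] using hy0 β t
    rw [← hT.le_iff, map_smul, he, map_zero] at hle
    have := hle s
    simp only [Pi.smul_apply, Pi.single_eq_same, smul_eq_mul, mul_one, Pi.zero_apply] at this
    exact hε'.not_ge this
  obtain ⟨α₀, hα⟩ := hyx β
  filter_upwards [eventually_ge_atTop α₀] with α hαα
  have h1 := hα α hαα
  rw [sub_zero, abs_of_nonneg (le_inf (abs_nonneg _) he0), ← hT.le_iff, hT.map_inf, hT.map_abs,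
    map_sub, he] at h1
  have h2 : min |T (x α) s - T a s| 1 ≤ T (y β) s := by simpa using h1 s
  rw [Real.dist_eq]
  rcases min_le_iff.1 h2 with h3 | h3
  · exact h3.trans_lt (hβ.trans_le (min_le_left _ _))
  · exact absurd (h3.trans_lt hβ) (min_le_right _ _).not_gt

/-- Reducing `u` to height at most `1 / (n + 1)` on a finite set stays inside `X`, as unit vectors
do. These elements have infimum `0`, and each is an eventual bound since only finitely many
coordinates need control. -/
theorem uoConverges_of_tendsto (hT : IsOrderDenseEmbedding T) {A : Type v} [Preorder A]
    [IsDirectedOrder A] [Nonempty A] {x : A → X} {a : X}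
    (h : ∀ s, Tendsto (fun α => T (x α) s) atTop (𝓝 (T a s))) : UOConverges x a := by
  classical
  intro u hu
  choose e he using hT.exists_single
  have hu0 : ∀ s, 0 ≤ T u s := fun s => by
    have := hT.le_iff.2 hu s
    rwa [map_zero] at this
  -- on `F` the bound is `min (T u) (1 / (n + 1))`, elsewhere it is `T u`
  set y : Finset S × ℕ → X := fun p =>
    u - ∑ s ∈ p.1, max (T u s - 1 / ((p.2 : ℝ) + 1)) 0 • e s with hy
  have hTy : ∀ p t, T (y p) t = if t ∈ p.1 then min (T u t) (1 / ((p.2 : ℝ) + 1)) else T u t := by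
    intro p t
    have h1 : (∑ s ∈ p.1, T (max (T u s - 1 / ((p.2 : ℝ) + 1)) 0 • e s)) t
        = if t ∈ p.1 then max (T u t - 1 / ((p.2 : ℝ) + 1)) 0 else 0 := by
      simp [Finset.sum_apply, he, Pi.single_apply]
    rw [hy, map_sub, map_sum, Pi.sub_apply, h1]
    split_ifs
    · rcases le_total (T u t) (1 / ((p.2 : ℝ) + 1)) with h2 | h2
      · rw [max_eq_right (sub_nonpos.2 h2), min_eq_left h2, sub_zero]
      · rw [max_eq_left (sub_nonneg.2 h2), min_eq_right h2, sub_sub_cancel]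
    · rw [sub_zero]
  have hanti : ∀ p q : Finset S × ℕ, p.1 ⊆ q.1 → p.2 ≤ q.2 → y q ≤ y p := by
    intro p q hF hn
    rw [← hT.le_iff]
    intro t
    have h1 : 1 / ((q.2 : ℝ) + 1) ≤ 1 / ((p.2 : ℝ) + 1) := by gcongr
    rw [hTy, hTy]
    by_cases hp : t ∈ p.1
    · rw [if_pos hp, if_pos (hF hp)]
      exact min_le_min_left _ h1
    · rw [if_neg hp]
      split_ifs
      · exact min_le_left _ _
      · exact le_rfl
  refine orderConverges_of_set (Set.range y) ⟨_, ⟨(∅, 0), rfl⟩⟩ ?_ ?_ ?_ ?_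
  · rintro _ ⟨p, rfl⟩ _ ⟨q, rfl⟩
    exact ⟨_, ⟨(p.1 ∪ q.1, max p.2 q.2), rfl⟩,
      hanti _ _ Finset.subset_union_left (le_max_left _ _),
      hanti _ _ Finset.subset_union_right (le_max_right _ _)⟩
  · intro z hz hzy
    refine le_antisymm ?_ hz
    rw [← hT.le_iff, map_zero]
    intro t
    refine le_of_forall_pos_lt_add fun ε hε => ?_
    obtain ⟨n, hn⟩ := exists_nat_one_div_lt hε
    have h1 := hT.le_iff.2 (hzy _ ⟨({t}, n), rfl⟩) t
    rw [hTy, if_pos (Finset.mem_singleton_self t)] at h1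
    simpa using (h1.trans (min_le_right _ _)).trans_lt hn
  · rintro _ ⟨p, rfl⟩
    rw [← hT.le_iff, map_zero]
    intro t
    rw [hTy]
    split_ifs
    · exact le_min (hu0 t) (by positivity)
    · exact hu0 t
  · rintro _ ⟨p, rfl⟩
    have hev : ∀ᶠ α in atTop, ∀ s ∈ p.1, |T (x α) s - T a s| < 1 / ((p.2 : ℝ) + 1) :=
      (Finset.eventually_all p.1).2 fun s _ =>
        Metric.tendsto_nhds.1 (h s) _ (by positivity)
    obtain ⟨α₀, hα⟩ := eventually_atTop.1 hev
    refine ⟨α₀, fun α hαα => ?_⟩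
    rw [sub_zero, abs_of_nonneg (le_inf (abs_nonneg _) hu), ← hT.le_iff, hT.map_inf, hT.map_abs,
      map_sub]
    intro t
    rw [hTy, Pi.inf_apply]
    split_ifs with ht
    · exact le_min inf_le_right (inf_le_left.trans (hα α hαα t ht).le)
    · exact inf_le_right

theorem uoConverges_iff (hT : IsOrderDenseEmbedding T) {A : Type v} [Preorder A]
    [IsDirectedOrder A] [Nonempty A] {x : A → X} {a : X} :
    UOConverges x a ↔ ∀ s, Tendsto (fun α => T (x α) s) atTop (𝓝 (T a s)) :=
  ⟨hT.tendsto_of_uoConverges, hT.uoConverges_of_tendsto⟩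

/-- The topology of pointwise convergence is locally convex-solid. -/
theorem isLocallyConvexSolid_induced (hT : IsOrderDenseEmbedding T) :
    IsLocallyConvexSolid (TopologicalSpace.induced T inferInstance) := by
  let : TopologicalSpace X := TopologicalSpace.induced T inferInstance
  have hgrp : IsTopologicalAddGroup X := topologicalAddGroup_induced T
  refine ⟨⟨hgrp, continuousSMul_induced T, ?_⟩, LocallyConvexSpace.induced T⟩
  refine hasBasis_self.2 fun U hU => ?_
  rw [nhds_induced, map_zero] at hU
  obtain ⟨V, hV, hVU⟩ := mem_comap.1 hU
  rw [nhds_pi, mem_pi] at hV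
  obtain ⟨I, hI, t, ht, htV⟩ := hV
  have hr : ∀ i, ∃ r > 0, Metric.ball (0 : ℝ) r ⊆ t i := fun i => Metric.mem_nhds_iff.1 (ht i)
  choose r hr0 hrt using hr
  refine ⟨T ⁻¹' (I.pi fun i => Metric.ball 0 (r i)), ?_, ?_, ?_⟩
  · rw [nhds_induced, map_zero]
    exact preimage_mem_comap (set_pi_mem_nhds hI fun i _ => Metric.ball_mem_nhds _ (hr0 i))
  · intro x hx y hyx i hi
    rw [← hT.le_iff, hT.map_abs, hT.map_abs] at hyx
    have h1 := hx i hi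
    rw [mem_ball_zero_iff, Real.norm_eq_abs] at h1 ⊢
    exact (hyx i).trans_lt h1
  · exact fun x hx => hVU (htV fun i hi => hrt i (hx i hi))

end IsOrderDenseEmbedding

end Pointwise

/-! ### Disjoint sequences are uo-null -/

section DisjointSequences

variable {X : Type u} [Lattice X] [AddCommGroup X] [IsOrderedAddMonoid X]

/-- Disjoint positive sequences in an Archimedean vector lattice are uo-null. -/
theorem IsArchimedeanVL.uoConverges_zero_of_disjoint (hX : IsArchimedeanVL X) {x : ℕ → X}
    (h0 : ∀ n, 0 ≤ x n) (hdisj : ∀ m n, m ≠ n → x m ⊓ x n = 0) : UOConverges x 0 := by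
  intro u hu
  set z : ℕ → X := fun n => x n ⊓ u with hz
  have hz0 : ∀ n, 0 ≤ z n := fun n => le_inf (h0 n) hu
  have hzu : ∀ n, z n ≤ u := fun n => inf_le_right
  have hzd : ∀ m n, m ≠ n → z m ⊓ z n = 0 := fun m n hmn =>
    inf_eq_zero_mono (hdisj m n hmn) (hz0 m) (hz0 n) inf_le_left inf_le_left
  set Y : Set X := {y | ∃ N, ∀ n ≥ N, z n ≤ y} with hY
  refine orderConverges_of_set Y ⟨u, 0, fun n _ => hzu n⟩ ?_ ?_ ?_ ?_
  · rintro y ⟨N, hN⟩ y' ⟨N', hN'⟩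
    exact ⟨y ⊓ y', ⟨max N N', fun n hn => le_inf (hN n (le_of_max_le_left hn))
      (hN' n (le_of_max_le_right hn))⟩, inf_le_left, inf_le_right⟩
  · intro w hw hwY
    -- Later terms are disjoint from `k z n`, so `u - (k z n) ⊓ u` is an eventual bound and
    -- dominates `w`. Hence `k (w ⊓ z n) ≤ u` improves to `k + 1`.
    have hwz : ∀ n, w ⊓ z n = 0 := by
      intro n
      have hv0 : 0 ≤ w ⊓ z n := le_inf hw (hz0 n)
      refine le_antisymm (hX.le_zero_of_step hu fun k hk => ?_) hv0
      have hmem : u - (k • z n) ⊓ u ∈ Y := ⟨n + 1, fun m hm => by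
        rw [le_sub_iff_add_le]
        refine add_le_of_inf_eq_zero ?_ (hzu m) inf_le_right
        have h1 := nsmul_inf_eq_zero (hzd n m (by omega)) k
        rw [inf_comm] at h1
        exact inf_eq_zero_mono h1 (hz0 m) (le_inf (nsmul_nonneg (hz0 n) k) hu) le_rfl inf_le_left⟩
      have h2 : k • (w ⊓ z n) ≤ (k • z n) ⊓ u := le_inf (nsmul_le_nsmul_right inf_le_right k) hk
      have h3 : w ⊓ z n ≤ u - k • (w ⊓ z n) :=
        inf_le_left.trans ((hwY _ hmem).trans (sub_le_sub_left h2 u))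
      rw [succ_nsmul']
      exact le_sub_iff_add_le.1 h3
    -- Being disjoint from all `z n`, `w` can be subtracted from any eventual bound; iterating from
    -- `u` gives `k w ≤ u` for all `k`.
    have hsub : ∀ y ∈ Y, y - w ∈ Y := by
      rintro y ⟨N, hN⟩
      refine ⟨N, fun n hn => le_sub_iff_add_le.2 ?_⟩
      exact add_le_of_inf_eq_zero (inf_comm w (z n) ▸ hwz n) (hN n hn) (hwY y ⟨N, hN⟩)
    have hk : ∀ k : ℕ, u - k • w ∈ Y := fun k => by
      induction k with
      | zero => rw [zero_smul, sub_zero]; exact ⟨0, fun n _ => hzu n⟩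
      | succ k ih => rw [succ_nsmul, ← sub_sub]; exact hsub _ ih
    refine le_antisymm (hX w u fun k => ?_) hw
    obtain ⟨N, hN⟩ := hk k
    exact sub_nonneg.1 ((hz0 N).trans (hN N le_rfl))
  · rintro y ⟨N, hN⟩
    exact (hz0 N).trans (hN N le_rfl)
  · rintro y ⟨N, hN⟩
    refine ⟨N, fun n hn => ?_⟩
    rw [sub_zero, sub_zero, abs_of_nonneg (h0 n), abs_of_nonneg (hz0 n)]
    exact hN n hn

end DisjointSequences

/-! ### Existence of atoms and disjoint systems -/

section Atoms

variable {X : Type u} [Lattice X] [AddCommGroup X] [IsOrderedAddMonoid X]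
  [Module ℝ X] [IsOrderedModule ℝ X]

/-- Below a positive element that dominates no atom there is an infinite disjoint sequence. -/
theorem IsArchimedeanVL.exists_disjoint_sequence (hX : IsArchimedeanVL X) {y : X} (hy : 0 < y)
    (h : ∀ a, a ≤ y → ¬ IsDiscreteElement a) :
    ∃ a : ℕ → X, (∀ n, 0 < a n ∧ a n ≤ y) ∧ ∀ m n, m ≠ n → a m ⊓ a n = 0 := by
  have hsplit : ∀ b : {b : X // 0 < b ∧ b ≤ y}, ∃ p q : X,
      0 < p ∧ 0 < q ∧ p ≤ b ∧ q ≤ b ∧ p ⊓ q = 0 := by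
    rintro ⟨b, hb, hby⟩
    by_contra! hcon
    exact h b hby (hX.isDiscreteElement_of_disjoint hb hcon)
  choose p q hp hq hpb hqb hpq using hsplit
  -- Each remainder splits into disjoint `p` and `q`: `p` is kept as a term and `q` is split again.
  set b : ℕ → {b : X // 0 < b ∧ b ≤ y} := fun n =>
    (fun c => ⟨q c, hq c, (hqb c).trans c.2.2⟩)^[n] ⟨y, hy, le_rfl⟩ with hb
  have hb1 : ∀ n, (b (n + 1) : X) = q (b n) := fun n => by
    simp only [hb, Function.iterate_succ_apply']
  have hanti : Antitone fun n => (b n : X) := antitone_nat_of_succ_le fun n => by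
    rw [hb1]; exact hqb _
  have hlt : ∀ m n, m < n → p (b m) ⊓ p (b n) = 0 := fun m n hmn => by
    refine inf_eq_zero_mono (hpq (b m)) (hp _).le (hp _).le le_rfl ((hpb _).trans ?_)
    rw [← hb1]
    exact hanti hmn
  refine ⟨fun n => p (b n), fun n => ⟨hp _, (hpb _).trans (b n).2.2⟩, fun m n hmn => ?_⟩
  rcases hmn.lt_or_gt with hmn | hmn
  · exact hlt m n hmn
  · rw [inf_comm]; exact hlt n m hmn

/-- An element disjoint from a maximal disjoint set of atoms would, if nonzero, dominate an atom
that could be adjoined. -/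
theorem isAtomicVL_of_forall_exists (h : ∀ x : X, 0 < x → ∃ a ≤ x, IsDiscreteElement a) :
    IsAtomicVL X := by
  obtain ⟨D, hD⟩ := zorn_subset {D : Set X | (∀ d ∈ D, IsDiscreteElement d) ∧
      ∀ d ∈ D, ∀ e ∈ D, d ≠ e → d ⊓ e = 0} fun c hc hchain => by
    refine ⟨⋃₀ c, ⟨?_, ?_⟩, fun s hs => Set.subset_sUnion_of_mem hs⟩
    · rintro d ⟨s, hs, hd⟩
      exact (hc hs).1 d hd
    · rintro d ⟨s, hs, hd⟩ e ⟨t, ht, he⟩ hde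
      rcases hchain.total hs ht with hst | hst
      · exact (hc ht).2 d (hst hd) e he hde
      · exact (hc hs).2 d hd e (hst he) hde
  refine ⟨D, hD.prop.1, hD.prop.2, fun x hx => ?_⟩
  by_contra hx0
  -- Disjointness from some `d₀` forces `0 ≤ x`. For empty `D` the sign of `x` is unknown, so `|x|`
  -- is used.
  rcases D.eq_empty_or_nonempty with hDe | ⟨d₀, hd₀⟩
  · obtain ⟨a, -, ha⟩ := h |x| ((abs_nonneg x).lt_of_ne' fun h0 => hx0 (le_antisymm
      ((le_abs_self x).trans h0.le) (neg_nonpos.1 ((neg_le_abs x).trans h0.le))))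
    have : a ∈ D := hD.le_of_ge (y := {a}) ⟨by simpa using ha, by
      rintro d rfl e rfl hde; exact absurd rfl hde⟩ (by simp [hDe]) rfl
    simp [hDe] at this
  have hxnn : 0 ≤ x := (hx d₀ hd₀).ge.trans inf_le_left
  obtain ⟨a, hax, ha⟩ := h x (hxnn.lt_of_ne' hx0)
  have had : ∀ d ∈ D, a ⊓ d = 0 := fun d hd =>
    inf_eq_zero_mono (hx d hd) ha.1.le ((hD.prop.1 d hd).1.le) hax le_rfl
  have haD : a ∈ D := by
    refine hD.le_of_ge (y := insert a D) ⟨?_, ?_⟩ (Set.subset_insert a D) (Set.mem_insert a D)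
    · rintro d (rfl | hd)
      exacts [ha, hD.prop.1 d hd]
    · rintro d (rfl | hd) e (rfl | he) hde
      · exact absurd rfl hde
      · exact had e he
      · rw [inf_comm]; exact had d hd
      · exact hD.prop.2 d hd e he hde
  exact ha.1.ne' (by simpa using had a haD)

end Atoms

/-! ### Topological uo-convergence forces atoms -/

section Topological

variable {X : Type u} [Lattice X] [AddCommGroup X] [IsOrderedAddMonoid X]
  [Module ℝ X] [IsOrderedModule ℝ X]

/-- The positive elements all of whose multiples have their order interval inside `C`. -/
def nullCone (C : Set X) : Set X :=
  {z | 0 ≤ z ∧ ∀ c : ℝ, 0 ≤ c → ∀ w, 0 ≤ w → w ≤ c • z → w ∈ C}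

/-- By Riesz decomposition `w` is a sum of parts below `c z₁` and `c z₂`, hence the midpoint of
their doubles, which lie in `C`. -/
theorem add_mem_nullCone {C : Set X} (hC : Convex ℝ C) {z₁ z₂ : X} (h₁ : z₁ ∈ nullCone C)
    (h₂ : z₂ ∈ nullCone C) : z₁ + z₂ ∈ nullCone C := by
  refine ⟨add_nonneg h₁.1 h₂.1, fun c hc w hw hwz => ?_⟩
  have hcz : 0 ≤ c • z₁ := smul_nonneg hc h₁.1
  set w₁ := w ⊓ c • z₁ with hw₁
  have hw₁0 : 0 ≤ w₁ := le_inf hw hcz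
  have hw₂0 : 0 ≤ w - w₁ := sub_nonneg.2 inf_le_left
  have hw₂ : w - w₁ ≤ c • z₂ := by
    rw [hw₁, sub_inf, sub_self]
    refine sup_le (smul_nonneg hc h₂.1) ?_
    rwa [sub_le_iff_le_add', ← smul_add]
  have m₁ : (2 : ℝ) • w₁ ∈ C := h₁.2 (2 * c) (by positivity) _ (smul_nonneg zero_le_two hw₁0) (by
    rw [mul_smul]; exact smul_le_smul_of_nonneg_left inf_le_right zero_le_two)
  have m₂ : (2 : ℝ) • (w - w₁) ∈ C :=
    h₂.2 (2 * c) (by positivity) _ (smul_nonneg zero_le_two hw₂0) (by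
      rw [mul_smul]; exact smul_le_smul_of_nonneg_left hw₂ zero_le_two)
  convert hC m₁ m₂ (a := 1 / 2) (b := 1 / 2) (by norm_num) (by norm_num) (by norm_num) using 1
  rw [smul_smul, smul_smul]
  norm_num

theorem smul_mem_of_mem_nullCone {C : Set X} {z : X} (h : z ∈ nullCone C) {c : ℝ} (hc : 0 ≤ c) :
    c • z ∈ C :=
  h.2 c hc _ (smul_nonneg hc h.1) le_rfl

/-- If every positive element below `x` dominates a nonzero element of the null cone of `C`, then
the elements `x - z` with `z` in the null cone and `z ≤ x` decrease to `0`. -/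
theorem IsArchimedeanVL.orderConverges_sub_nullCone (hX : IsArchimedeanVL X) {C : Set X}
    (hC : Convex ℝ C) (hC0 : (0 : X) ∈ C) {x : X} (hx : 0 < x)
    (h : ∀ y, 0 < y → y ≤ x → ∃ z ∈ nullCone C, 0 < z ∧ z ≤ y)
    (hsup : ∀ z₁ ∈ nullCone C, ∀ z₂ ∈ nullCone C, z₁ ⊔ z₂ ∈ nullCone C) :
    OrderConverges (fun z : {z : X // z ∈ nullCone C ∧ z ≤ x} => x - z) 0 := by
  have h0 : (0 : X) ∈ nullCone C := ⟨le_rfl, fun c _ w hw hwc => by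
    rw [smul_zero] at hwc
    rwa [le_antisymm hwc hw]⟩
  refine orderConverges_of_set {y | ∃ z ∈ nullCone C, z ≤ x ∧ y = x - z}
    ⟨x, 0, h0, hx.le, (sub_zero x).symm⟩ ?_ ?_ ?_ ?_
  · rintro _ ⟨z₁, h₁, hx₁, rfl⟩ _ ⟨z₂, h₂, hx₂, rfl⟩
    exact ⟨_, ⟨z₁ ⊔ z₂, hsup _ h₁ _ h₂, sup_le hx₁ hx₂, rfl⟩, sub_le_sub_left le_sup_left x,
      sub_le_sub_left le_sup_right x⟩
  · intro w hw hwY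
    by_contra hw0
    have hwx : w ≤ x := hwY x ⟨0, h0, hx.le, (sub_zero x).symm⟩
    obtain ⟨v, hv, hv0, hvw⟩ := h w (hw.lt_of_ne' hw0) hwx
    -- If `k v` is admissible, then `v ≤ w ≤ x - k v`, so `(k + 1) v` is too.
    have hk : ∀ k : ℕ, k • v ∈ nullCone C ∧ k • v ≤ x := fun k => by
      induction k with
      | zero => rw [zero_smul]; exact ⟨h0, hx.le⟩
      | succ k ih =>
        rw [succ_nsmul]
        refine ⟨add_mem_nullCone hC ih.1 hv, ?_⟩
        exact le_sub_iff_add_le'.1 (hvw.trans (hwY _ ⟨_, ih.1, ih.2, rfl⟩))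
    exact hv0.not_ge (hX v x fun k => (hk k).2)
  · rintro _ ⟨z, hz, hzx, rfl⟩
    exact sub_nonneg.2 hzx
  · rintro _ ⟨z, hz, hzx, rfl⟩
    refine ⟨⟨z, hz, hzx⟩, fun z' hz' => ?_⟩
    rw [sub_zero, abs_of_nonneg (sub_nonneg.2 z'.2.2)]
    exact sub_le_sub_left (show z ≤ (z' : X) from hz') x

/-- Needed because the topological hypothesis concerns index sets in one fixed universe. -/
theorem UOConverges.comp_uLift_down {A : Type w} [Preorder A] {x : A → X} {a : X}
    (h : UOConverges x a) : UOConverges (fun α : ULift.{v} A => x α.down) a := fun u hu => by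
  obtain ⟨B, i₁, i₂, i₃, y, hy, hyx⟩ := h u hu
  exact ⟨B, i₁, i₂, i₃, y, hy, fun β => (hyx β).elim fun α₀ hα =>
    ⟨⟨α₀⟩, fun α hαα => hα α.down hαα⟩⟩

theorem isDirectedOrder_uLift {A : Type w} [Preorder A] [IsDirectedOrder A] :
    IsDirectedOrder (ULift.{v} A) :=
  ⟨fun a b => (exists_ge_ge a.down b.down).elim fun c hc => ⟨⟨c⟩, hc.1, hc.2⟩⟩

/-- If uo-convergence agrees with convergence in a locally convex topology, then the space is
atomic. -/
theorem IsArchimedeanVL.isAtomicVL_of_topological (hX : IsArchimedeanVL X)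
    [TopologicalSpace X] [IsTopologicalAddGroup X] [ContinuousSMul ℝ X] [LocallyConvexSpace ℝ X]
    (h : ∀ (A : Type (max u v)) [Preorder A] [IsDirectedOrder A] [Nonempty A] (x : A → X) (a : X),
      UOConverges x a ↔ Tendsto x atTop (𝓝 a)) : IsAtomicVL X := by
  refine isAtomicVL_of_forall_exists fun x hx => ?_
  obtain ⟨C, hCn, hC, hxC⟩ : ∃ C ∈ 𝓝 (0 : X), Convex ℝ C ∧ x ∉ C := by
    have h1 : ¬ Tendsto (fun _ : PUnit.{max u v + 1} => x) atTop (𝓝 0) := fun h1 =>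
      not_uoConverges_const hx ((h _ _ _).2 h1)
    rw [(LocallyConvexSpace.convex_basis_zero ℝ X).tendsto_right_iff] at h1
    push Not at h1
    obtain ⟨C, ⟨hCn, hC⟩, hxC⟩ := h1
    refine ⟨C, hCn, hC, fun hmem => ?_⟩
    simp [hmem] at hxC
  have hC0 : (0 : X) ∈ C := mem_of_mem_nhds hCn
  have hsup : ∀ z₁ ∈ nullCone C, ∀ z₂ ∈ nullCone C, z₁ ⊔ z₂ ∈ nullCone C := fun z₁ h₁ z₂ h₂ => by
    have h12 := add_mem_nullCone hC h₁ h₂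
    refine ⟨h₁.1.trans le_sup_left, fun c hc w hw hwz => h12.2 c hc w hw (hwz.trans ?_)⟩
    exact smul_le_smul_of_nonneg_left
      (sup_le (le_add_of_nonneg_right h₂.1) (le_add_of_nonneg_left h₁.1)) hc
  obtain ⟨y, hy, hyx, hyC⟩ : ∃ y, 0 < y ∧ y ≤ x ∧ ∀ z, 0 < z → z ≤ y → z ∉ nullCone C := by
    by_contra! hcon
    have hconv := hX.orderConverges_sub_nullCone hC hC0 hx
      (fun y hy hyx => by
        obtain ⟨z, hz0, hzy, hz⟩ := hcon y hy hyx
        exact ⟨z, hz, hz0, hzy⟩) hsup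
    have hdir : IsDirectedOrder {z : X // z ∈ nullCone C ∧ z ≤ x} := ⟨fun a b =>
      ⟨⟨(a : X) ⊔ b, hsup _ a.2.1 _ b.2.1, sup_le a.2.2 b.2.2⟩,
        (le_sup_left : (a : X) ≤ (a : X) ⊔ b), (le_sup_right : (b : X) ≤ (a : X) ⊔ b)⟩⟩
    obtain ⟨z₀, hz₀, hz₀x, hz₀C⟩ := hcon x hx le_rfl
    have : Nonempty {z : X // z ∈ nullCone C ∧ z ≤ x} := ⟨⟨z₀, hz₀C, hz₀x⟩⟩
    have : IsDirectedOrder (ULift.{max u v} {z : X // z ∈ nullCone C ∧ z ≤ x}) :=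
      isDirectedOrder_uLift
    have ht := (h _ _ _).1 (UOConverges.comp_uLift_down.{u, max u v} hconv.uoConverges)
    -- Doubling the net places `2(x - z)` in `C`; with `2z ∈ C`, convexity gives the midpoint `x`.
    have ht2 := ht.add ht
    rw [add_zero] at ht2
    obtain ⟨⟨z, hz, _⟩, hzC⟩ := (ht2.eventually hCn).exists
    have h2z := smul_mem_of_mem_nullCone hz zero_le_two
    have hmid := hC hzC h2z (a := 1 / 2) (b := 1 / 2) (by norm_num) (by norm_num) (by norm_num)
    refine hxC ?_
    convert hmid using 1
    module
  by_contra! hcon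
  obtain ⟨a, ha, hdisj⟩ := hX.exists_disjoint_sequence hy fun b hby => hcon b (hby.trans hyx)
  have hw : ∀ n, ∃ c : ℝ, 0 ≤ c ∧ ∃ w, 0 ≤ w ∧ w ≤ c • a n ∧ w ∉ C := fun n => by
    by_contra! hn
    exact hyC (a n) (ha n).1 (ha n).2 ⟨(ha n).1.le, hn⟩
  choose c hc w hw0 hwc hwC using hw
  have huo : UOConverges w 0 := hX.uoConverges_zero_of_disjoint hw0 fun m n hmn =>
    inf_eq_zero_mono (smul_inf_smul_eq_zero (hdisj m n hmn) (hc m) (hc n)) (hw0 m) (hw0 n)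
      (hwc m) (hwc n)
  have : IsDirectedOrder (ULift.{max u v} ℕ) := isDirectedOrder_uLift
  have hev := ((h _ _ _).1 (UOConverges.comp_uLift_down.{u, max u v} huo)).eventually hCn
  obtain ⟨n, hn⟩ := hev.exists
  exact hwC _ hn

end Topological

theorem theorem7p5 {X : Type u} [Lattice X] [AddCommGroup X] [IsOrderedAddMonoid X]
    [Module ℝ X] [IsOrderedModule ℝ X] (hX : IsArchimedeanVL X) :
    ((∃ t : TopologicalSpace X, IsLocallyConvexSolid t ∧
        ∀ (A : Type (max u v)) [Preorder A] [IsDirectedOrder A] [Nonempty A] (x : A → X) (a : X),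
          UOConverges x a ↔ Tendsto x atTop (𝓝 a)) ↔
      IsAtomicVL X) ∧
    (IsAtomicVL X →
      (∃ (S : Type u) (T : X →ₗ[ℝ] (S → ℝ)), IsOrderDenseEmbedding T) ∧
      ∀ (S : Type w) (T : X →ₗ[ℝ] (S → ℝ)), IsOrderDenseEmbedding T →
        ∀ (A : Type (max u v)) [Preorder A] [IsDirectedOrder A] [Nonempty A] (x : A → X) (a : X),
          UOConverges x a ↔ ∀ s : S, Tendsto (fun α => T (x α) s) atTop (𝓝 (T a s))) := by
  refine ⟨⟨?_, fun h => ?_⟩, fun h => ⟨h.exists_embedding hX, fun S T hT A _ _ _ x a =>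
    hT.uoConverges_iff⟩⟩
  · rintro ⟨t, ht, h⟩
    have := ht.isTopologicalAddGroup
    have := ht.continuousSMul
    have := ht.locallyConvex
    exact IsArchimedeanVL.isAtomicVL_of_topological.{u, v} hX h
  · obtain ⟨S, T, hT⟩ := h.exists_embedding hX
    refine ⟨_, hT.isLocallyConvexSolid_induced, fun A _ _ _ x a => ?_⟩
    rw [hT.uoConverges_iff, nhds_induced, tendsto_comap_iff, tendsto_pi_nhds]
    rfl
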